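/- Let $K$ be a field with $\operatorname{char}(K)\neq 2$. For a Lie algebra $\mathfrak g$ over $K$ let $\mathfrak g^{\psi}$ be an isomorphic copy of $\mathfrak g$, the isomorphism being written $x\mapsto x^{\psi}$, and let $$\chi(\mathfrak g)=\langle\, \mathfrak g,\ \mathfrak g^{\psi}\ \mid\ [x,x^{\psi}]=0 \text{ for all } x\in\mathfrak g\,\rangle$$ be the quotient of the free product of the Lie algebras $\mathfrak g$ and $\mathfrak g^{\psi}$ by the ideal generated by all $[x,x^{\psi}]$, $x\in\mathfrak g$. Let $\alpha:\chi(\mathfrak g)\to\mathfrak g$ be the homomorphism with $\alpha(x)=\alpha(x^{\psi})=x$ for all $x\in\mathfrak g$, let $L(\mathfrak g)=\ker\alpha$, and let $$R(\mathfrak g)=[\mathfrak g,[L(\mathfrak g),\mathfrak g^{\psi}]]\subseteq\chi(\mathfrak g),$$ where $[A,B]$ denotes the linear span of all $[a,b]$ with $a\in A$, $b\in B$. For $m\ge 0$ and $c\ge 1$ let $\mathfrak n_{m,c}=F/\gamma_{c+1}(F)$ be the free nilpotent Lie algebra over $K$ of rank $m$ and class $c$, where $F$ is the free Lie algebra on $m$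 generators and $\gamma_1(F)=F$, $\gamma_{k+1}(F)=[F,\gamma_k(F)]$. Then for every $m$ the spaces $R(\mathfrak n_{m,2})$ and $R(\mathfrak n_{m,3})$ are finite-dimensional, and $$\dim_K R(\mathfrak n_{m,2})=\dim_K R(\mathfrak n_{m,3})=\frac{1}{24}\left(3m^4-2m^3-15m^2+14m\right).$$ -/

import Mathlib

noncomputable section

universe u v w

/-- The generator of the free Lie algebra on `𝔤 ⊕ 𝔤` that stands for `x` in the first copy. -/
abbrev WeakComm.genInl (R : Type u) {𝔤 : Type v} [CommRing R] (x : 𝔤) : FreeLieAlgebra R (𝔤 ⊕ 𝔤) :=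
  FreeLieAlgebra.of R (Sum.inl x)

/-- The generator of the free Lie algebra on `𝔤 ⊕ 𝔤` that stands for `x^ψ` in the second copy. -/
abbrev WeakComm.genInr (R : Type u) {𝔤 : Type v} [CommRing R] (x : 𝔤) : FreeLieAlgebra R (𝔤 ⊕ 𝔤) :=
  FreeLieAlgebra.of R (Sum.inr x)

/-- The defining relators of the weak commutativity construction on a Lie algebra `𝔤`, in the free
Lie algebra on two copies of (the set underlying) `𝔤`: `genInl x` stands for `x` and `genInr x`
for `x^ψ`. The first six families say that each copy is a homomorphic image of `𝔤`
(so they present the free product of `𝔤` and `𝔤^ψ`), the last one says `[x, x^ψ] = 0`. -/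
inductive WeakComm.Relator (R : Type u) (𝔤 : Type v) [CommRing R] [LieRing 𝔤] [LieAlgebra R 𝔤] :
    FreeLieAlgebra R (𝔤 ⊕ 𝔤) → Prop
  | add_inl (x y : 𝔤) : WeakComm.Relator R 𝔤
      (WeakComm.genInl R (x + y)
        - (WeakComm.genInl R x + WeakComm.genInl R y))
  | smul_inl (t : R) (x : 𝔤) : WeakComm.Relator R 𝔤
      (WeakComm.genInl R (t • x) - t • WeakComm.genInl R x)
  | lie_inl (x y : 𝔤) : WeakComm.Relator R 𝔤
      (WeakComm.genInl R ⁅x, y⁆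
        - ⁅WeakComm.genInl R x, WeakComm.genInl R y⁆)
  | add_inr (x y : 𝔤) : WeakComm.Relator R 𝔤
      (WeakComm.genInr R (x + y)
        - (WeakComm.genInr R x + WeakComm.genInr R y))
  | smul_inr (t : R) (x : 𝔤) : WeakComm.Relator R 𝔤
      (WeakComm.genInr R (t • x) - t • WeakComm.genInr R x)
  | lie_inr (x y : 𝔤) : WeakComm.Relator R 𝔤
      (WeakComm.genInr R ⁅x, y⁆
        - ⁅WeakComm.genInr R x, WeakComm.genInr R y⁆)
  | comm (x : 𝔤) : WeakComm.Relator R 𝔤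
      ⁅WeakComm.genInl R x, WeakComm.genInr R x⁆

/-- The ideal of the free Lie algebra on `𝔤 ⊕ 𝔤` generated by the defining relators. -/
abbrev WeakComm.relIdeal (R : Type u) (𝔤 : Type v) [CommRing R] [LieRing 𝔤] [LieAlgebra R 𝔤] :
    LieIdeal R (FreeLieAlgebra R (𝔤 ⊕ 𝔤)) :=
  LieSubmodule.lieSpan R (FreeLieAlgebra R (𝔤 ⊕ 𝔤)) {z | WeakComm.Relator R 𝔤 z}

/-- The weak commutativity construction
`χ(𝔤) = ⟨𝔤, 𝔤^ψ ∣ [x, x^ψ] = 0 for all x ∈ 𝔤⟩`. -/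
abbrev WeakComm (R : Type u) (𝔤 : Type v) [CommRing R] [LieRing 𝔤] [LieAlgebra R 𝔤] :=
  FreeLieAlgebra R (𝔤 ⊕ 𝔤) ⧸ WeakComm.relIdeal R 𝔤

namespace WeakComm

section

variable (R : Type u) (𝔤 : Type v) [CommRing R] [LieRing 𝔤] [LieAlgebra R 𝔤]

/-- The quotient map from the free Lie algebra onto `χ(𝔤)`. -/
def mk : FreeLieAlgebra R (𝔤 ⊕ 𝔤) →ₗ⁅R⁆ WeakComm R 𝔤 :=
  { (LieSubmodule.Quotient.mk' (relIdeal R 𝔤) : _ →ₗ[R] WeakComm R 𝔤) with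
    map_lie' := fun {_ _} => rfl }

theorem mk_relator {z : FreeLieAlgebra R (𝔤 ⊕ 𝔤)} (hz : Relator R 𝔤 z) : mk R 𝔤 z = 0 :=
  LieSubmodule.Quotient.mk_eq_zero'.mpr (LieSubmodule.subset_lieSpan hz)

/-- The canonical homomorphism `𝔤 → χ(𝔤)`, `x ↦ x`. -/
def inl : 𝔤 →ₗ⁅R⁆ WeakComm R 𝔤 where
  toFun x := mk R 𝔤 (genInl R x)
  map_add' x y := by
    have h := mk_relator R 𝔤 (Relator.add_inl x y)
    rwa [map_sub, map_add, sub_eq_zero] at h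
  map_smul' t x := by
    have h := mk_relator R 𝔤 (Relator.smul_inl t x)
    rwa [map_sub, map_smul, sub_eq_zero] at h
  map_lie' {x y} := by
    have h := mk_relator R 𝔤 (Relator.lie_inl x y)
    rwa [map_sub, LieHom.map_lie, sub_eq_zero] at h

/-- The canonical homomorphism `𝔤 → χ(𝔤)`, `x ↦ x^ψ`. -/
def inr : 𝔤 →ₗ⁅R⁆ WeakComm R 𝔤 where
  toFun x := mk R 𝔤 (genInr R x)
  map_add' x y := by
    have h := mk_relator R 𝔤 (Relator.add_inr x y)
    rwa [map_sub, map_add, sub_eq_zero] at h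
  map_smul' t x := by
    have h := mk_relator R 𝔤 (Relator.smul_inr t x)
    rwa [map_sub, map_smul, sub_eq_zero] at h
  map_lie' {x y} := by
    have h := mk_relator R 𝔤 (Relator.lie_inr x y)
    rwa [map_sub, LieHom.map_lie, sub_eq_zero] at h

variable {𝔤} {M : Type w} [LieRing M] [LieAlgebra R M]

/-- On generators, the map induced by a pair of homomorphisms out of `𝔤`. -/
def liftAux (f g : 𝔤 →ₗ⁅R⁆ M) : FreeLieAlgebra R (𝔤 ⊕ 𝔤) →ₗ⁅R⁆ M :=
  FreeLieAlgebra.lift R (Sum.elim f g)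

theorem relIdeal_le_ker (f g : 𝔤 →ₗ⁅R⁆ M) (h : ∀ x, ⁅f x, g x⁆ = 0) :
    relIdeal R 𝔤 ≤ (liftAux R f g).ker := by
  refine LieSubmodule.lieSpan_le.mpr ?_
  rintro z hz
  rw [SetLike.mem_coe, LieHom.mem_ker]
  cases hz <;> simp [liftAux, h]

/-- The universal property of `χ(𝔤)`: homomorphisms `f`, `g` with `[f x, g x] = 0` for all `x`
induce a homomorphism with `x ↦ f x` and `x^ψ ↦ g x`. -/
def lift (f g : 𝔤 →ₗ⁅R⁆ M) (h : ∀ x, ⁅f x, g x⁆ = 0) : WeakComm R 𝔤 →ₗ⁅R⁆ M :=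
  { (relIdeal R 𝔤).toSubmodule.liftQ (liftAux R f g : FreeLieAlgebra R (𝔤 ⊕ 𝔤) →ₗ[R] M)
      (fun _ hz => relIdeal_le_ker R f g h hz) with
    map_lie' := by
      rintro ⟨x⟩ ⟨y⟩
      exact (liftAux R f g).map_lie x y }

@[simp] theorem lift_inl (f g : 𝔤 →ₗ⁅R⁆ M) (h : ∀ x, ⁅f x, g x⁆ = 0) (x : 𝔤) :
    lift R f g h (inl R 𝔤 x) = f x :=
  FreeLieAlgebra.lift_of_apply (R := R) (Sum.elim f g) (Sum.inl x)

@[simp] theorem lift_inr (f g : 𝔤 →ₗ⁅R⁆ M) (h : ∀ x, ⁅f x, g x⁆ = 0) (x : 𝔤) :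
    lift R f g h (inr R 𝔤 x) = g x :=
  FreeLieAlgebra.lift_of_apply (R := R) (Sum.elim f g) (Sum.inr x)

variable (𝔤)

/-- The homomorphism `α : χ(𝔤) → 𝔤` with `α(x) = α(x^ψ) = x`. -/
def alpha : WeakComm R 𝔤 →ₗ⁅R⁆ 𝔤 :=
  lift R LieHom.id LieHom.id (fun x => by simp only [LieHom.id_apply, lie_self])

@[simp] theorem alpha_inl (x : 𝔤) : alpha R 𝔤 (inl R 𝔤 x) = x := by
  simp only [alpha, lift_inl, LieHom.id_apply]

@[simp] theorem alpha_inr (x : 𝔤) : alpha R 𝔤 (inr R 𝔤 x) = x := by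
  simp only [alpha, lift_inr, LieHom.id_apply]

/-- The ideal `L(𝔤) = ker α` of `χ(𝔤)`. -/
def idealL : LieIdeal R (WeakComm R 𝔤) := (alpha R 𝔤).ker

end

/-- The product `[A, B]` of two subspaces of a Lie algebra: the linear span of all `[a, b]` with
`a ∈ A` and `b ∈ B`. -/
def bracketSpan {R : Type u} {M : Type w} [CommRing R] [LieRing M] [LieAlgebra R M]
    (A B : Submodule R M) : Submodule R M :=
  Submodule.span R {z | ∃ a ∈ A, ∃ b ∈ B, ⁅a, b⁆ = z}

/-- `R(𝔤) = [𝔤, [L(𝔤), 𝔤^ψ]]`, as a subspace of `χ(𝔤)`. -/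
def idealR (R : Type u) (𝔤 : Type v) [CommRing R] [LieRing 𝔤] [LieAlgebra R 𝔤] :
    Submodule R (WeakComm R 𝔤) :=
  bracketSpan (inl R 𝔤).range.toSubmodule
    (bracketSpan (idealL R 𝔤).toSubmodule (inr R 𝔤).range.toSubmodule)

end WeakComm

/-- The free nilpotent Lie algebra `𝔫_{m,c}` of rank `m` and class `c`: the free Lie algebra `F` of
rank `m` modulo `γ_{c+1}(F)`. (Mathlib numbers the lower central series from `0`, so that
`lowerCentralSeries R F F c` is `γ_{c+1}(F)`.) -/
abbrev FreeNilpotentLie (R : Type u) [CommRing R] (m c : ℕ) :=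
  FreeLieAlgebra R (Fin m) ⧸
    LieModule.lowerCentralSeries R (FreeLieAlgebra R (Fin m)) (FreeLieAlgebra R (Fin m)) c

end

noncomputable section

universe u v

open scoped TensorProduct

/-! Write e(x) = x + x^ψ, o(x) = x - x^ψ and x∧y = [o(x), o(y)]. Polarising [x, x^ψ] = 0 gives
[e(x), o(y)] = o([x, y]) and x∧y = 2e([x, y]) - [e(x), e(y)], whence [x∧y, o(z)] = o([[x, y], z]).
So when 2 is invertible the o(x) and x∧y span L(𝔤), and R(𝔤) is spanned by the Jacobi elements J(x,
y, z) = x∧[y, z] + y∧[z, x] + z∧[x, y] (`idealR_eq_span_jac`).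

J is alternating, and skew-symmetry of [x∧y, a∧b] gives J(a, b, [x, y]) = -J(x, y, [a, b]). In class
at most three, J vanishes once an entry lies in γ_3 or two entries lie in γ_2. With V the span of
the generators, R(𝔤) is therefore a quotient of Λ³V ⊕ Λ²(Λ²V), of dimension C(m,3) + C(C(m,2),2).

The bound is attained for class at least two: with H the class two model, χ(𝔤) acts through a Lie
algebra on H ⊕ H ⊕ (H ⊗ H) in which x∧y has tensor part x⊗y - y⊗x, and coordinate functionals
separate the spanning family (`linearIndependent_jacFamily`). Neither estimate distinguishes class 2
from class 3, so the two dimensions agree. -/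

/-- A Lie subalgebra that contains the generators of a free Lie algebra is everything. -/
theorem FreeLieAlgebra.mem_of_forall_of_mem {R : Type*} {X : Type*} [CommRing R]
    (H : LieSubalgebra R (FreeLieAlgebra R X)) (h : ∀ i, FreeLieAlgebra.of R i ∈ H)
    (x : FreeLieAlgebra R X) : x ∈ H := by
  have key : H.incl.comp (FreeLieAlgebra.lift R (fun i => (⟨FreeLieAlgebra.of R i, h i⟩ : H))) =
      LieHom.id := by
    apply FreeLieAlgebra.hom_ext
    intro i
    simp
  have hx := LieHom.congr_fun key x
  rw [LieHom.id_apply] at hx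
  rw [← hx]
  exact Subtype.property _

namespace WeakComm

/-! ### Generation of χ(𝔤) by the two copies of 𝔤 -/

section Generation

variable (R : Type u) {𝔤 : Type v} [CommRing R] [LieRing 𝔤] [LieAlgebra R 𝔤]

theorem mk_surjective : Function.Surjective (mk R 𝔤) := by
  rintro ⟨x⟩
  exact ⟨x, rfl⟩

/-- A Lie subalgebra of `χ(𝔤)` that contains both copies of `𝔤` is everything. -/
theorem mem_of_forall_inl_inr_mem (H : LieSubalgebra R (WeakComm R 𝔤))
    (hl : ∀ x, inl R 𝔤 x ∈ H) (hr : ∀ x, inr R 𝔤 x ∈ H) (z : WeakComm R 𝔤) : z ∈ H := by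
  obtain ⟨x, rfl⟩ := mk_surjective R z
  have := FreeLieAlgebra.mem_of_forall_of_mem (H.comap (mk R 𝔤)) (by
    rintro (i | i)
    · exact hl i
    · exact hr i) x
  exact this

/-- A subspace of `χ(𝔤)` that contains both copies of `𝔤` and is stable under bracketing with them
is everything. -/
theorem mem_of_forall_lie_mem (P : Submodule R (WeakComm R 𝔤))
    (hl : ∀ x, inl R 𝔤 x ∈ P) (hr : ∀ x, inr R 𝔤 x ∈ P)
    (hll : ∀ x, ∀ p ∈ P, ⁅inl R 𝔤 x, p⁆ ∈ P) (hlr : ∀ x, ∀ p ∈ P, ⁅inr R 𝔤 x, p⁆ ∈ P)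
    (z : WeakComm R 𝔤) : z ∈ P := by
  -- The elements that bracket P into itself form a subalgebra; it contains both copies, hence is
  -- everything, so P is itself a subalgebra.
  let N : LieSubalgebra R (WeakComm R 𝔤) :=
    { carrier := {z | ∀ p ∈ P, ⁅z, p⁆ ∈ P}
      add_mem' := fun ha hb p hp => by rw [add_lie]; exact add_mem (ha p hp) (hb p hp)
      zero_mem' := fun p _ => by rw [zero_lie]; exact zero_mem P
      smul_mem' := fun t a ha p hp => by rw [smul_lie]; exact P.smul_mem t (ha p hp)
      lie_mem' := fun ha hb p hp => by
        rw [lie_lie]; exact sub_mem (ha _ (hb p hp)) (hb _ (ha p hp)) }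
  exact mem_of_forall_inl_inr_mem R
    { P with lie_mem' := fun {a b} _ hb => mem_of_forall_inl_inr_mem R N hll hlr a b hb } hl hr z

theorem lie_inl_inr_self (x : 𝔤) : ⁅inl R 𝔤 x, inr R 𝔤 x⁆ = 0 := by
  have h := mk_relator R 𝔤 (Relator.comm x)
  rwa [LieHom.map_lie] at h

/-- Polarisation of [x, x^ψ] = 0. -/
theorem lie_inr_inl (x y : 𝔤) : ⁅inr R 𝔤 x, inl R 𝔤 y⁆ = ⁅inl R 𝔤 x, inr R 𝔤 y⁆ := by
  have h := lie_inl_inr_self R (x + y)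
  rw [map_add, map_add, add_lie, lie_add, lie_add, lie_inl_inr_self, lie_inl_inr_self, zero_add,
    add_zero] at h
  rw [← lie_skew, neg_eq_iff_add_eq_zero, add_comm]
  exact h

end Generation

/-! ### Commutation identities for x + x^ψ and x - x^ψ -/

section Identities

variable (R : Type u) {𝔤 : Type v} [CommRing R] [LieRing 𝔤] [LieAlgebra R 𝔤]

/-- The element `x + x^ψ` of `χ(𝔤)`, as a linear map. -/
def even : 𝔤 →ₗ[R] WeakComm R 𝔤 := (inl R 𝔤 : 𝔤 →ₗ[R] _) + (inr R 𝔤 : 𝔤 →ₗ[R] _)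

/-- The element `x - x^ψ` of `χ(𝔤)`, as a linear map. -/
def odd : 𝔤 →ₗ[R] WeakComm R 𝔤 := (inl R 𝔤 : 𝔤 →ₗ[R] _) - (inr R 𝔤 : 𝔤 →ₗ[R] _)

theorem even_apply (x : 𝔤) : even R x = inl R 𝔤 x + inr R 𝔤 x := rfl

theorem odd_apply (x : 𝔤) : odd R x = inl R 𝔤 x - inr R 𝔤 x := rfl

/-- The element `[x - x^ψ, y - y^ψ]` of `χ(𝔤)`, as a bilinear map. -/
def wedge : 𝔤 →ₗ[R] 𝔤 →ₗ[R] WeakComm R 𝔤 :=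
  LinearMap.mk₂ R (fun x y => ⁅odd R x, odd R y⁆) (by simp) (by simp) (by simp) (by simp)

theorem wedge_apply (x y : 𝔤) : wedge R x y = ⁅odd R x, odd R y⁆ := rfl

theorem wedge_skew (x y : 𝔤) : -wedge R y x = wedge R x y := by
  simp [wedge_apply]

theorem lie_even_odd (x y : 𝔤) : ⁅even R x, odd R y⁆ = odd R ⁅x, y⁆ := by
  simp only [even_apply, odd_apply, lie_sub, add_lie, lie_inr_inl, LieHom.map_lie]
  abel

theorem wedge_eq (x y : 𝔤) :
    wedge R x y = (2 : R) • even R ⁅x, y⁆ - ⁅even R x, even R y⁆ := by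
  simp only [wedge_apply, even_apply, odd_apply, lie_sub, sub_lie, lie_add, add_lie, lie_inr_inl,
    LieHom.map_lie, two_smul]
  abel

/-- By `wedge_eq` the wedge acts on odd elements as 2 ad[x, y] - [ad x, ad y] = ad[x, y]. -/
theorem lie_wedge_odd (x y z : 𝔤) : ⁅wedge R x y, odd R z⁆ = odd R ⁅⁅x, y⁆, z⁆ := by
  rw [wedge_eq, sub_lie, smul_lie, lie_even_odd, lie_lie (even R x), lie_even_odd, lie_even_odd,
    lie_even_odd, lie_even_odd, ← map_sub, ← lie_lie, two_smul, add_sub_cancel_right]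

theorem lie_even_wedge (x y z : 𝔤) :
    ⁅even R x, wedge R y z⁆ = wedge R ⁅x, y⁆ z + wedge R y ⁅x, z⁆ := by
  simp only [wedge_apply]
  rw [leibniz_lie, lie_even_odd, lie_even_odd]

theorem lie_wedge_wedge (x y z t : 𝔤) :
    ⁅wedge R x y, wedge R z t⁆ = wedge R ⁅⁅x, y⁆, z⁆ t + wedge R z ⁅⁅x, y⁆, t⁆ := by
  rw [wedge_apply R z t, leibniz_lie, lie_wedge_odd, lie_wedge_odd, wedge_apply, wedge_apply]

/-- Skew-symmetry of the bracket of two wedges, each order being expanded by `lie_wedge_wedge`. All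
further relations among wedges come from this one. -/
theorem wedge_lie_lie (x y z t : 𝔤) :
    wedge R ⁅⁅x, y⁆, z⁆ t + wedge R z ⁅⁅x, y⁆, t⁆
      + (wedge R ⁅⁅z, t⁆, x⁆ y + wedge R x ⁅⁅z, t⁆, y⁆) = 0 := by
  rw [← lie_wedge_wedge, ← lie_wedge_wedge, ← lie_skew, neg_add_cancel]

theorem lie_odd_wedge (x y z : 𝔤) : ⁅odd R x, wedge R y z⁆ = odd R ⁅x, ⁅y, z⁆⁆ := by
  rw [← lie_skew, lie_wedge_odd, ← map_neg, lie_skew]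

theorem two_smul_inl (x : 𝔤) : (2 : R) • inl R 𝔤 x = even R x + odd R x := by
  rw [even_apply, odd_apply, two_smul]; abel

theorem two_smul_inr (x : 𝔤) : (2 : R) • inr R 𝔤 x = even R x - odd R x := by
  rw [even_apply, odd_apply, two_smul]; abel

/-- The Jacobi element `x ∧ [y, z] + y ∧ [z, x] + z ∧ [x, y]` of `χ(𝔤)`, linear in `z`. -/
def jac (x y : 𝔤) : 𝔤 →ₗ[R] WeakComm R 𝔤 :=
  (wedge R x) ∘ₗ (LieAlgebra.ad R 𝔤 y : 𝔤 →ₗ[R] 𝔤)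
    - (wedge R y) ∘ₗ (LieAlgebra.ad R 𝔤 x : 𝔤 →ₗ[R] 𝔤) + (wedge R).flip ⁅x, y⁆

theorem jac_apply (x y z : 𝔤) :
    jac R x y z = wedge R x ⁅y, z⁆ - wedge R y ⁅x, z⁆ + wedge R z ⁅x, y⁆ := rfl

theorem jac_swap (x y z : 𝔤) : jac R y x z = -jac R x y z := by
  rw [jac_apply, jac_apply, ← lie_skew x y, map_neg]
  abel

theorem jac_rotate (x y z : 𝔤) : jac R x y z = jac R y z x := by
  rw [jac_apply, jac_apply, ← lie_skew x z, ← lie_skew x y, map_neg, map_neg]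
  abel

end Identities

/-! ### Spanning sets for L(𝔤) and R(𝔤) -/

section Span

variable {K : Type u} {𝔤 : Type v} [Field K] [LieRing 𝔤] [LieAlgebra K 𝔤]

theorem inl_eq (h2 : (2 : K) ≠ 0) (x : 𝔤) :
    inl K 𝔤 x = (2⁻¹ : K) • (even K x + odd K x) := by
  rw [← two_smul_inl, inv_smul_smul₀ h2]

variable (K 𝔤) in
/-- The linear span of the elements `x - x^ψ` and of their brackets. -/
def oddSpan : Submodule K (WeakComm K 𝔤) :=
  LinearMap.range (odd K : 𝔤 →ₗ[K] _) ⊔ Submodule.span K {z | ∃ x y : 𝔤, wedge K x y = z}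

theorem odd_mem_oddSpan (x : 𝔤) : odd K x ∈ oddSpan K 𝔤 :=
  Submodule.mem_sup_left ⟨x, rfl⟩

theorem wedge_mem_oddSpan (x y : 𝔤) : wedge K x y ∈ oddSpan K 𝔤 :=
  Submodule.mem_sup_right (Submodule.subset_span ⟨x, y, rfl⟩)

theorem oddSpan_le {P : Submodule K (WeakComm K 𝔤)} (ho : ∀ x : 𝔤, odd K x ∈ P)
    (hw : ∀ x y : 𝔤, wedge K x y ∈ P) : oddSpan K 𝔤 ≤ P := by
  refine sup_le ?_ (Submodule.span_le.mpr ?_)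
  · rintro _ ⟨x, rfl⟩
    exact ho x
  · rintro _ ⟨x, y, rfl⟩
    exact hw x y

theorem lie_even_mem_oddSpan (x : 𝔤) {z : WeakComm K 𝔤} (hz : z ∈ oddSpan K 𝔤) :
    ⁅even K x, z⁆ ∈ oddSpan K 𝔤 := by
  have : oddSpan K 𝔤 ≤ (oddSpan K 𝔤).comap (LieAlgebra.ad K _ (even K x) : _ →ₗ[K] _) := by
    refine oddSpan_le (fun y => ?_) (fun y t => ?_)
    · simpa [lie_even_odd] using odd_mem_oddSpan _
    · simpa [lie_even_wedge] using add_mem (wedge_mem_oddSpan _ _) (wedge_mem_oddSpan _ _)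
  exact this hz

theorem lie_odd_mem_oddSpan (x : 𝔤) {z : WeakComm K 𝔤} (hz : z ∈ oddSpan K 𝔤) :
    ⁅odd K x, z⁆ ∈ oddSpan K 𝔤 := by
  have : oddSpan K 𝔤 ≤ (oddSpan K 𝔤).comap (LieAlgebra.ad K _ (odd K x) : _ →ₗ[K] _) := by
    refine oddSpan_le (fun y => ?_) (fun y t => ?_)
    · exact wedge_mem_oddSpan _ _
    · simpa [lie_odd_wedge] using odd_mem_oddSpan _
  exact this hz

/-- Since x^ψ = x - (x - x^ψ), it suffices that `oddSpan` is stable under the first copy and under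
odd elements; stability under x uses x = (even + odd)/2. -/
theorem exists_eq_inl_add (h2 : (2 : K) ≠ 0) (z : WeakComm K 𝔤) :
    ∃ x : 𝔤, ∃ l ∈ oddSpan K 𝔤, z = inl K 𝔤 x + l := by
  have hl : ∀ x : 𝔤, ∀ p ∈ oddSpan K 𝔤, ⁅inl K 𝔤 x, p⁆ ∈ oddSpan K 𝔤 := by
    intro x p hp
    rw [inl_eq h2, smul_lie, add_lie]
    exact Submodule.smul_mem _ _
      (add_mem (lie_even_mem_oddSpan x hp) (lie_odd_mem_oddSpan x hp))
  have hinr : ∀ x : 𝔤, inr K 𝔤 x = inl K 𝔤 x - odd K x := by simp [odd_apply]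
  have hz : z ∈ LinearMap.range (inl K 𝔤 : 𝔤 →ₗ[K] WeakComm K 𝔤) ⊔ oddSpan K 𝔤 := by
    have hll : ∀ x : 𝔤, ∀ p ∈ LinearMap.range (inl K 𝔤 : 𝔤 →ₗ[K] WeakComm K 𝔤) ⊔ oddSpan K 𝔤,
        ⁅inl K 𝔤 x, p⁆ ∈ LinearMap.range (inl K 𝔤 : 𝔤 →ₗ[K] WeakComm K 𝔤) ⊔ oddSpan K 𝔤 := by
      intro x p hp
      obtain ⟨_, ⟨y, rfl⟩, l, hl', rfl⟩ := Submodule.mem_sup.mp hp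
      rw [lie_add]
      exact add_mem (Submodule.mem_sup_left ⟨⁅x, y⁆, LieHom.map_lie _ _ _⟩)
        (Submodule.mem_sup_right (hl x l hl'))
    refine mem_of_forall_lie_mem K
      (LinearMap.range (inl K 𝔤 : 𝔤 →ₗ[K] WeakComm K 𝔤) ⊔ oddSpan K 𝔤) (fun x => Submodule.mem_sup_left ⟨x, rfl⟩) (fun x => ?_) hll
      (fun x p hp => ?_) z
    · rw [hinr]
      exact sub_mem (Submodule.mem_sup_left ⟨x, rfl⟩)
        (Submodule.mem_sup_right (odd_mem_oddSpan x))
    · rw [hinr, sub_lie]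
      refine sub_mem (hll x p hp) (Submodule.mem_sup_right ?_)
      obtain ⟨_, ⟨y, rfl⟩, l, hl', rfl⟩ := Submodule.mem_sup.mp hp
      rw [lie_add, ← lie_skew]
      exact add_mem (neg_mem (hl y _ (odd_mem_oddSpan x))) (lie_odd_mem_oddSpan x hl')
  obtain ⟨_, ⟨y, rfl⟩, l, hl', rfl⟩ := Submodule.mem_sup.mp hz
  exact ⟨y, l, hl', rfl⟩

theorem alpha_odd (x : 𝔤) : alpha K 𝔤 (odd K x) = 0 := by
  rw [odd_apply, map_sub, alpha_inl, alpha_inr, sub_self]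

/-- In characteristic other than two, `L(𝔤)` is spanned by the `x - x^ψ` and their brackets. -/
theorem idealL_eq_oddSpan (h2 : (2 : K) ≠ 0) : (idealL K 𝔤).toSubmodule = oddSpan K 𝔤 := by
  have hle : oddSpan K 𝔤 ≤ (idealL K 𝔤).toSubmodule := by
    refine oddSpan_le (fun x => ?_) (fun x y => ?_)
    · exact LieHom.mem_ker.mpr (alpha_odd x)
    · refine LieHom.mem_ker.mpr ?_
      rw [wedge_apply, LieHom.map_lie, alpha_odd, zero_lie]
  refine le_antisymm (fun z hz => ?_) hle
  obtain ⟨x, l, hl, rfl⟩ := exists_eq_inl_add h2 z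
  have h : alpha K 𝔤 (inl K 𝔤 x + l) = 0 := LieHom.mem_ker.mp hz
  have h' : alpha K 𝔤 l = 0 := LieHom.mem_ker.mp (hle hl)
  rw [map_add, alpha_inl, h', add_zero] at h
  rwa [h, map_zero, zero_add]

/-- Substitute 2x = even + odd and 2y^ψ = even - odd: the two odd terms cancel and only wedges
remain. -/
theorem four_smul_lie_inl_lie_inr_odd (x y z : 𝔤) :
    (2 : K) • (2 : K) • ⁅inl K 𝔤 x, ⁅inr K 𝔤 y, odd K z⁆⁆ = jac K x y z := by
  rw [← lie_smul, ← smul_lie, ← smul_lie, two_smul_inl, two_smul_inr]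
  simp only [sub_lie, lie_even_odd, ← wedge_apply, lie_sub, add_lie, lie_even_wedge,
    lie_odd_wedge, jac_apply]
  rw [← wedge_skew K ⁅x, y⁆ z]
  abel

theorem four_smul_lie_inl_lie_inr_wedge (x y z t : 𝔤) :
    (2 : K) • (2 : K) • ⁅inl K 𝔤 x, ⁅inr K 𝔤 y, wedge K z t⁆⁆
      = -(jac K x ⁅y, z⁆ t + jac K x z ⁅y, t⁆) := by
  rw [← lie_smul, ← smul_lie, ← smul_lie, two_smul_inl, two_smul_inr]
  simp only [sub_lie, lie_even_wedge, lie_odd_wedge, lie_sub, add_lie, lie_add, lie_even_odd,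
    jac_apply]
  rw [leibniz_lie y z t, lie_add, ← wedge_apply, map_add, map_add,
    ← wedge_skew K t ⁅x, ⁅y, z⁆⁆, ← wedge_skew K ⁅y, t⁆ ⁅x, z⁆]
  generalize wedge K ⁅x, ⁅y, z⁆⁆ t = a1, wedge K ⁅y, z⁆ ⁅x, t⁆ = a2, wedge K ⁅x, z⁆ ⁅y, t⁆ = a3,
    wedge K z ⁅x, ⁅y, t⁆⁆ = a4, wedge K x ⁅⁅y, z⁆, t⁆ = a5, wedge K x ⁅z, ⁅y, t⁆⁆ = a6,
    odd K ⁅x, ⁅⁅y, z⁆, t⁆⁆ = a7, odd K ⁅x, ⁅z, ⁅y, t⁆⁆⁆ = a8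
  abel

/-- In characteristic other than two, `R(𝔤)` is spanned by the Jacobi elements. -/
theorem idealR_eq_span_jac (h2 : (2 : K) ≠ 0) :
    idealR K 𝔤 = Submodule.span K {w | ∃ x y z : 𝔤, jac K x y z = w} := by
  set T := Submodule.span K {w | ∃ x y z : 𝔤, jac K x y z = w} with hT
  have hjac : ∀ x y z : 𝔤, jac K x y z ∈ T := fun x y z => Submodule.subset_span ⟨x, y, z, rfl⟩
  have h4 : ∀ w : WeakComm K 𝔤, (2 : K) • (2 : K) • w ∈ T → w ∈ T := fun w hw => by
    rwa [T.smul_mem_iff h2, T.smul_mem_iff h2] at hw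
  apply le_antisymm
  · refine Submodule.span_le.mpr ?_
    rintro _ ⟨_, ⟨x, rfl⟩, b, hb, rfl⟩
    have hle : bracketSpan (idealL K 𝔤).toSubmodule (inr K 𝔤).range.toSubmodule
        ≤ T.comap (LieAlgebra.ad K _ (inl K 𝔤 x) : _ →ₗ[K] _) := by
      refine Submodule.span_le.mpr ?_
      rintro _ ⟨a, ha, _, ⟨y, rfl⟩, rfl⟩
      rw [idealL_eq_oddSpan h2] at ha
      have hle' : oddSpan K 𝔤 ≤ T.comap ((LieAlgebra.ad K _ (inl K 𝔤 x) : _ →ₗ[K] _) ∘ₗ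
          (LieAlgebra.ad K _ (inr K 𝔤 y) : WeakComm K 𝔤 →ₗ[K] _)) := by
        refine oddSpan_le (fun z => h4 _ ?_) (fun z t => h4 _ ?_)
        · exact (four_smul_lie_inl_lie_inr_odd (K := K) x y z).symm ▸ hjac x y z
        · exact (four_smul_lie_inl_lie_inr_wedge (K := K) x y z t).symm ▸
            neg_mem (add_mem (hjac _ _ _) (hjac _ _ _))
      change ⁅inl K 𝔤 x, ⁅a, inr K 𝔤 y⁆⁆ ∈ T
      rw [← lie_skew a, lie_neg]
      exact neg_mem (S := Submodule K (WeakComm K 𝔤)) (hle' ha)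
    exact hle hb
  · refine Submodule.span_le.mpr ?_
    rintro _ ⟨x, y, z, rfl⟩
    rw [← four_smul_lie_inl_lie_inr_odd, SetLike.mem_coe]
    refine Submodule.smul_mem _ _ (Submodule.smul_mem _ _ ?_)
    refine Submodule.subset_span ⟨_, ⟨x, rfl⟩, _, ?_, rfl⟩
    rw [← lie_skew]
    refine neg_mem (Submodule.subset_span ⟨_, ?_, _, ⟨y, rfl⟩, rfl⟩)
    exact (LieHom.mem_ker (f := alpha K 𝔤)).mpr (alpha_odd z)

end Span

end WeakComm

/-! ### Reduction of alternating families to increasing indices -/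

section SkewFamilies

variable {K : Type*} {M : Type*} {ι : Type*} [Field K] [AddCommGroup M] [Module K M] [LinearOrder ι]

theorem eq_zero_of_eq_neg_self (h2 : (2 : K) ≠ 0) {x : M} (h : x = -x) : x = 0 := by
  have : (2 : K) • x = 0 := by rw [two_smul]; nth_rewrite 1 [h]; exact neg_add_cancel x
  exact (smul_eq_zero_iff_right h2).mp this

theorem Submodule.mem_of_skew (h2 : (2 : K) ≠ 0) (T : Submodule K M) (G : ι → ι → M)
    (hs : ∀ i j, G j i = -G i j) (h : ∀ i j, i < j → G i j ∈ T) (i j : ι) : G i j ∈ T := by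
  rcases lt_trichotomy i j with hij | rfl | hij
  · exact h i j hij
  · rw [eq_zero_of_eq_neg_self h2 (hs i i)]
    exact zero_mem T
  · rw [hs]
    exact neg_mem (h j i hij)

theorem Submodule.mem_of_skew_of_rotate (h2 : (2 : K) ≠ 0) (T : Submodule K M)
    (G : ι → ι → ι → M) (hs : ∀ i j k, G j i k = -G i j k) (hr : ∀ i j k, G i j k = G j k i)
    (h : ∀ i j k, i < j → j < k → G i j k ∈ T) (i j k : ι) : G i j k ∈ T := by
  have h0 : ∀ i k, G i i k = 0 := fun i k => eq_zero_of_eq_neg_self h2 (hs i i k)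
  have hle : ∀ i j k, i ≤ j → j ≤ k → G i j k ∈ T := by
    intro i j k hij hjk
    rcases hij.eq_or_lt with rfl | hij
    · rw [h0]; exact zero_mem T
    rcases hjk.eq_or_lt with rfl | hjk
    · rw [hr, h0]; exact zero_mem T
    exact h i j k hij hjk
  have hswap : ∀ i j k, G i j k = -G i k j := fun i j k => by
    rw [hr i j k, hr i k j, hs j k i, neg_neg]
  rcases le_total i j with hij | hij <;> rcases le_total j k with hjk | hjk <;>
    rcases le_total i k with hik | hik
  · exact hle i j k hij hjk
  · exact hle i j k hij hjk
  · rw [hswap]; exact neg_mem (hle i k j hik hjk)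
  · rw [hr, hr]; exact hle k i j hik hij
  · rw [hs]; exact neg_mem (hle j i k hij hik)
  · rw [hr]; exact hle j k i hjk hik
  · rw [hr, hr, hs, hr]; exact neg_mem (hle k j i hjk hij)
  · rw [hr, hr, hs, hr]; exact neg_mem (hle k j i hjk hij)

/-- The order embedding `Fin 2 ↪o ι` given by a pair `i < j`. -/
def OrderEmbedding.pair {i j : ι} (h : i < j) : Fin 2 ↪o ι :=
  OrderEmbedding.ofStrictMono ![i, j] (by
    intro a b hab
    fin_cases a <;> fin_cases b <;> simp_all)

/-- The order embedding `Fin 3 ↪o ι` given by a triple `i < j < k`. -/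
def OrderEmbedding.triple {i j k : ι} (h : i < j) (h' : j < k) : Fin 3 ↪o ι :=
  OrderEmbedding.ofStrictMono ![i, j, k] (by
    have := h.trans h'
    intro a b hab
    fin_cases a <;> fin_cases b <;> simp_all)

theorem card_orderEmbedding_fin (n m : ℕ) : Fintype.card (Fin n ↪o Fin m) = m.choose n := by
  rw [← Nat.card_eq_fintype_card, Nat.card_congr Set.powersetCard.ofFinEmbEquiv,
    Set.powersetCard.card, Nat.card_eq_fintype_card, Fintype.card_fin]

/-- An enumeration of the pairs `i < j` in `Fin m`. -/
def pairEnum (m : ℕ) : Fin (m.choose 2) ≃ (Fin 2 ↪o Fin m) :=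
  (Fintype.equivFinOfCardEq (card_orderEmbedding_fin 2 m)).symm

end SkewFamilies

namespace WeakComm

/-! ### Spanning R(𝔤) in class at most three -/

section ClassThree

variable {K : Type u} {𝔤 : Type v} [Field K] [LieRing 𝔤] [LieAlgebra K 𝔤]

theorem lie_lie_lie_lie_eq_zero (hg : ∀ a b c d : 𝔤, ⁅a, ⁅b, ⁅c, d⁆⁆⁆ = 0) (a b c d : 𝔤) :
    ⁅⁅a, b⁆, ⁅c, d⁆⁆ = 0 := by
  rw [lie_lie, hg, hg, sub_zero]

/-- In `wedge_lie_lie` for x, y, c, [a, b], class three kills every term except [[x, y], c]∧[a, b].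
-/
theorem wedge_lie_lie_lie_eq_zero (hg : ∀ a b c d : 𝔤, ⁅a, ⁅b, ⁅c, d⁆⁆⁆ = 0) (a b c x y : 𝔤) :
    wedge K ⁅a, b⁆ ⁅c, ⁅x, y⁆⁆ = 0 := by
  have h := wedge_lie_lie K x y c ⁅a, b⁆
  have h0 : ∀ t : 𝔤, ⁅⁅c, ⁅a, b⁆⁆, t⁆ = 0 := fun t => by
    rw [← lie_skew, hg, neg_zero]
  rw [lie_lie_lie_lie_eq_zero hg, h0, h0, map_zero, map_zero, map_zero, LinearMap.zero_apply,
    add_zero, add_zero, add_zero, ← wedge_skew,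
    ← lie_skew _ c, map_neg, neg_neg] at h
  exact h

theorem jac_lie_lie_eq_zero (hg : ∀ a b c d : 𝔤, ⁅a, ⁅b, ⁅c, d⁆⁆⁆ = 0) (x a b c d : 𝔤) :
    jac K x ⁅a, b⁆ ⁅c, d⁆ = 0 := by
  rw [jac_apply, lie_lie_lie_lie_eq_zero hg, wedge_lie_lie_lie_eq_zero hg,
    wedge_lie_lie_lie_eq_zero hg, map_zero, sub_zero, add_zero]

theorem jac_lie_lie_lie_eq_zero (hg : ∀ a b c d : 𝔤, ⁅a, ⁅b, ⁅c, d⁆⁆⁆ = 0) (x y a b c : 𝔤) :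
    jac K x y ⁅a, ⁅b, c⁆⁆ = 0 := by
  rw [jac_apply, hg, hg, ← wedge_skew K _ ⁅x, y⁆, wedge_lie_lie_lie_eq_zero hg, map_zero, map_zero, sub_zero,
    neg_zero, add_zero]

/-- In the sum of the two Jacobi elements the terms [x, y]∧[a, b] and [a, b]∧[x, y] cancel, and the
rest is `wedge_lie_lie` up to sign. No nilpotency enters. -/
theorem jac_lie_skew (x y a b : 𝔤) :
    jac K a b ⁅x, y⁆ = -jac K x y ⁅a, b⁆ := by
  have h := wedge_lie_lie K x y a b
  rw [← lie_skew ⁅x, y⁆ a, ← lie_skew ⁅x, y⁆ b, ← lie_skew ⁅a, b⁆ x, ← lie_skew ⁅a, b⁆ y,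
    ← wedge_skew K _ b, ← wedge_skew K _ y] at h
  rw [eq_neg_iff_add_eq_zero, ← neg_eq_zero, ← h, jac_apply, jac_apply,
    ← wedge_skew K ⁅x, y⁆ ⁅a, b⁆]
  simp only [map_neg]
  abel

/-- The Jacobi elements at `e i, e j, e k` with `i < j < k`, and at `e i, e j, [e k, e l]` where
`i < j`, `k < l` and the pair `(i, j)` precedes `(k, l)`. -/
def jacFamily (K : Type u) {𝔤 : Type v} [Field K] [LieRing 𝔤] [LieAlgebra K 𝔤] {m : ℕ}
    (e : Fin m → 𝔤) : (Fin 3 ↪o Fin m) ⊕ (Fin 2 ↪o Fin (m.choose 2)) → WeakComm K 𝔤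
  | Sum.inl f => jac K (e (f 0)) (e (f 1)) (e (f 2))
  | Sum.inr f => jac K (e (pairEnum m (f 0) 0)) (e (pairEnum m (f 0) 1))
      ⁅e (pairEnum m (f 1) 0), e (pairEnum m (f 1) 1)⁆

/-- A linear map sends everything to `T` if it sends the generators and all brackets there. -/
theorem map_mem_of_generates {m : ℕ} {e : Fin m → 𝔤} {M : Type*} [AddCommGroup M] [Module K M]
    (he : LieSubalgebra.lieSpan K 𝔤 (Set.range e) = ⊤) (T : Submodule K M) (f : 𝔤 →ₗ[K] M)
    (h1 : ∀ i, f (e i) ∈ T) (h2 : ∀ a b : 𝔤, f ⁅a, b⁆ ∈ T) (x : 𝔤) : f x ∈ T := by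
  let N : LieSubalgebra K 𝔤 := { T.comap f with lie_mem' := fun {a b} _ _ => h2 a b }
  have hN : LieSubalgebra.lieSpan K 𝔤 (Set.range e) ≤ N := by
    refine LieSubalgebra.lieSpan_le.mpr ?_
    rintro _ ⟨i, rfl⟩
    exact h1 i
  rw [he] at hN
  exact hN (LieSubalgebra.mem_top x)

theorem jac_lie_mem (h2 : (2 : K) ≠ 0) (hg : ∀ a b c d : 𝔤, ⁅a, ⁅b, ⁅c, d⁆⁆⁆ = 0) {m : ℕ}
    {e : Fin m → 𝔤} (he : LieSubalgebra.lieSpan K 𝔤 (Set.range e) = ⊤) (x y a b : 𝔤) :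
    jac K x y ⁅a, b⁆ ∈ Submodule.span K (Set.range (jacFamily K e)) := by
  set T := Submodule.span K (Set.range (jacFamily K e)) with hT
  have hb : ∀ i j k l, jac K (e i) (e j) ⁅e k, e l⁆ ∈ T := by
    have hs : ∀ x y a b : 𝔤, jac K x y ⁅b, a⁆ = -jac K x y ⁅a, b⁆ := fun x y a b => by
      rw [← lie_skew, map_neg]
    -- By `jac_lie_skew` the value is skew in the two pairs, so pairs in increasing order suffice.
    have hp : ∀ f f' : Fin 2 ↪o Fin m, jac K (e (f 0)) (e (f 1)) ⁅e (f' 0), e (f' 1)⁆ ∈ T := by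
      intro f f'
      have := T.mem_of_skew h2
        (fun s t => jac K (e (pairEnum m s 0)) (e (pairEnum m s 1))
          ⁅e (pairEnum m t 0), e (pairEnum m t 1)⁆)
        (fun s t => jac_lie_skew _ _ _ _)
        (fun s t hst => Submodule.subset_span ⟨Sum.inr (OrderEmbedding.pair hst), rfl⟩)
        ((pairEnum m).symm f) ((pairEnum m).symm f')
      simpa using this
    intro i j k l
    refine T.mem_of_skew h2 (fun k l => jac K (e i) (e j) ⁅e k, e l⁆) (fun k l => hs _ _ _ _)
      (fun k l hkl => ?_) k l
    refine T.mem_of_skew h2 (fun i j => jac K (e i) (e j) ⁅e k, e l⁆)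
      (fun i j => jac_swap K _ _ _) (fun i j hij => ?_) i j
    exact hp (OrderEmbedding.pair hij) (OrderEmbedding.pair hkl)
  -- Generators are now freed one at a time: each entry is either a generator, already treated, or a
  -- bracket, where the class three vanishing applies.
  have h3 : ∀ i j k b, jac K (e i) (e j) ⁅e k, b⁆ ∈ T := fun i j k =>
    map_mem_of_generates he T ((jac K (e i) (e j)).comp (LieAlgebra.ad K 𝔤 (e k) : 𝔤 →ₗ[K] 𝔤))
      (hb i j k) (fun a b => by
        simp [jac_lie_lie_lie_eq_zero hg])
  have h4 : ∀ i j b a, jac K (e i) (e j) ⁅b, a⁆ ∈ T := fun i j b =>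
    map_mem_of_generates he T ((jac K (e i) (e j)).comp (LieAlgebra.ad K 𝔤 b : 𝔤 →ₗ[K] 𝔤))
      (fun k => by
        have := neg_mem (h3 i j k b)
        rw [← map_neg, lie_skew] at this
        exact this) (fun c d => by
        simp [jac_lie_lie_lie_eq_zero hg])
  have h5 : ∀ i a b y, jac K ⁅a, b⁆ (e i) y ∈ T := fun i a b =>
    map_mem_of_generates he T (jac K ⁅a, b⁆ (e i))
      (fun j => by rw [jac_rotate]; exact h4 _ _ _ _) (fun c d => by
        rw [jac_rotate, jac_lie_lie_eq_zero hg]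
        exact zero_mem T)
  have h6 : ∀ y x, jac K y ⁅a, b⁆ x ∈ T := fun y =>
    map_mem_of_generates he T (jac K y ⁅a, b⁆)
      (fun j => by rw [jac_rotate]; exact h5 _ _ _ _) (fun c d => by
        rw [jac_lie_lie_eq_zero hg]
        exact zero_mem T)
  rw [jac_rotate]
  exact h6 _ _

/-- In a Lie algebra of class at most three generated by the `e i`, in characteristic other than
two, the Jacobi elements of `jacFamily` span `R(𝔤)`. -/
theorem idealR_eq_span_jacFamily (h2 : (2 : K) ≠ 0)
    (hg : ∀ a b c d : 𝔤, ⁅a, ⁅b, ⁅c, d⁆⁆⁆ = 0) {m : ℕ}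
    {e : Fin m → 𝔤} (he : LieSubalgebra.lieSpan K 𝔤 (Set.range e) = ⊤) :
    idealR K 𝔤 = Submodule.span K (Set.range (jacFamily K e)) := by
  rw [idealR_eq_span_jac h2]
  apply le_antisymm
  · refine Submodule.span_le.mpr ?_
    set T := Submodule.span K (Set.range (jacFamily K e)) with hT
    have hj := jac_lie_mem h2 hg he
    have h0 : ∀ i j k, jac K (e i) (e j) (e k) ∈ T :=
      T.mem_of_skew_of_rotate h2 (fun i j k => jac K (e i) (e j) (e k))
        (fun i j k => jac_swap K _ _ _) (fun i j k => jac_rotate K _ _ _)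
        (fun i j k hij hjk =>
          Submodule.subset_span ⟨Sum.inl (OrderEmbedding.triple hij hjk), rfl⟩)
    have h1 : ∀ i j z, jac K (e i) (e j) z ∈ T := fun i j =>
      map_mem_of_generates he T _ (h0 i j) (hj _ _)
    have h2' : ∀ i z y, jac K z (e i) y ∈ T := fun i z =>
      map_mem_of_generates he T _ (fun j => by rw [jac_rotate]; exact h1 _ _ _) (hj _ _)
    rintro _ ⟨x, y, z, rfl⟩
    rw [jac_rotate]
    exact map_mem_of_generates he T _ (fun j => by rw [jac_rotate]; exact h2' _ _ _) (hj _ _) x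
  · refine Submodule.span_mono ?_
    rintro _ ⟨f | f, rfl⟩
    · exact ⟨_, _, _, rfl⟩
    · exact ⟨_, _, _, rfl⟩

end ClassThree

end WeakComm

/-! ### The class two model and the Lie algebra detecting R -/

section Model

variable (K : Type u) [Field K] (m : ℕ)

/-- The Lie algebra `K^m ⊕ M_m(K)` with bracket `[v, v'] = v v'ᵀ - v' vᵀ` on `K^m` and with `M_m(K)`
central. -/
def ClassTwoModel : Type u := (Fin m → K) × (Fin m → Fin m → K)

namespace ClassTwoModel

instance : AddCommGroup (ClassTwoModel K m) :=
  inferInstanceAs (AddCommGroup ((Fin m → K) × (Fin m → Fin m → K)))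

instance : Module K (ClassTwoModel K m) :=
  inferInstanceAs (Module K ((Fin m → K) × (Fin m → Fin m → K)))

variable {K m}

/-- The `i`-th coordinate of the first component. -/
def coordFst (i : Fin m) : ClassTwoModel K m →ₗ[K] K :=
  (LinearMap.proj i) ∘ₗ (LinearMap.fst K (Fin m → K) (Fin m → Fin m → K))

/-- The `(i, j)`-th coordinate of the second component. -/
def coordSnd (i j : Fin m) : ClassTwoModel K m →ₗ[K] K :=
  (LinearMap.proj j) ∘ₗ (LinearMap.proj i) ∘ₗ (LinearMap.snd K (Fin m → K) (Fin m → Fin m → K))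

theorem ext_coord {x y : ClassTwoModel K m} (h1 : ∀ i, coordFst i x = coordFst i y)
    (h2 : ∀ i j, coordSnd i j x = coordSnd i j y) : x = y :=
  Prod.ext (funext h1) (funext fun i => funext (h2 i))

instance : Bracket (ClassTwoModel K m) (ClassTwoModel K m) where
  bracket x y := ((0 : Fin m → K), fun i j => x.1 i * y.1 j - y.1 i * x.1 j)

theorem coordFst_lie (i : Fin m) (x y : ClassTwoModel K m) : coordFst i ⁅x, y⁆ = 0 := rfl

theorem coordSnd_lie (i j : Fin m) (x y : ClassTwoModel K m) :
    coordSnd i j ⁅x, y⁆ = coordFst i x * coordFst j y - coordFst i y * coordFst j x := rfl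

instance : LieRing (ClassTwoModel K m) where
  add_lie x y z := ext_coord (by simp [coordFst_lie]) (by simp [coordSnd_lie]; intros; ring)
  lie_add x y z := ext_coord (by simp [coordFst_lie]) (by simp [coordSnd_lie]; intros; ring)
  lie_self x := ext_coord (by simp [coordFst_lie]) (by simp [coordSnd_lie])
  leibniz_lie x y z := ext_coord (by simp [coordFst_lie]) (by simp [coordSnd_lie, coordFst_lie])

instance : LieAlgebra K (ClassTwoModel K m) where
  lie_smul t x y := ext_coord (by simp [coordFst_lie]) (by simp [coordSnd_lie]; intros; ring)

theorem lie_lie_eq_zero (x y z : ClassTwoModel K m) : ⁅x, ⁅y, z⁆⁆ = 0 :=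
  ext_coord (by simp [coordFst_lie]) (by simp [coordSnd_lie, coordFst_lie])

theorem lie_lie_eq_zero' (x y z : ClassTwoModel K m) : ⁅⁅x, y⁆, z⁆ = 0 :=
  ext_coord (by simp [coordFst_lie]) (by simp [coordSnd_lie, coordFst_lie])

/-- The `i`-th standard generator. -/
def gen (i : Fin m) : ClassTwoModel K m := (Pi.single i 1, 0)

theorem coordFst_gen (i j : Fin m) :
    coordFst i (gen j : ClassTwoModel K m) = if i = j then 1 else 0 :=
  Pi.single_apply j (1 : K) i

theorem coordSnd_gen (i j k : Fin m) : coordSnd i j (gen k : ClassTwoModel K m) = 0 := rfl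

theorem lie_lie_tensor_eq_zero (x y : ClassTwoModel K m)
    (a : ClassTwoModel K m ⊗[K] ClassTwoModel K m) : ⁅⁅x, y⁆, a⁆ = 0 := by
  induction a using TensorProduct.induction_on with
  | zero => simp
  | tmul p q =>
    rw [TensorProduct.LieModule.lie_tmul_right, lie_lie_eq_zero', lie_lie_eq_zero',
      TensorProduct.zero_tmul, TensorProduct.tmul_zero, add_zero]
  | add p q hp hq => rw [lie_add, hp, hq, add_zero]

theorem lie_lie_tensor_comm (x y : ClassTwoModel K m)
    (a : ClassTwoModel K m ⊗[K] ClassTwoModel K m) : ⁅x, ⁅y, a⁆⁆ = ⁅y, ⁅x, a⁆⁆ := by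
  rw [leibniz_lie, lie_lie_tensor_eq_zero, zero_add]

end ClassTwoModel

/-- A Lie algebra structure on `H ⊕ H ⊕ (H ⊗ H)` for `H = ClassTwoModel K m`: the target of a
representation of `χ(H)` in which `x + x^ψ` and `x - x^ψ` act as the elements `x` of the first two
summands. -/
def WeakCommModel : Type u :=
  ClassTwoModel K m × ClassTwoModel K m × (ClassTwoModel K m ⊗[K] ClassTwoModel K m)

namespace WeakCommModel

instance : AddCommGroup (WeakCommModel K m) :=
  inferInstanceAs (AddCommGroup
    (ClassTwoModel K m × ClassTwoModel K m × (ClassTwoModel K m ⊗[K] ClassTwoModel K m)))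

instance : Module K (WeakCommModel K m) :=
  inferInstanceAs (Module K
    (ClassTwoModel K m × ClassTwoModel K m × (ClassTwoModel K m ⊗[K] ClassTwoModel K m)))

variable {K m}

/-- The projection onto the first summand. -/
def even : WeakCommModel K m →ₗ[K] ClassTwoModel K m := LinearMap.fst K _ _

/-- The projection onto the second summand. -/
def odd : WeakCommModel K m →ₗ[K] ClassTwoModel K m := LinearMap.fst K _ _ ∘ₗ LinearMap.snd K _ _

/-- The projection onto the third summand. -/
def tensor : WeakCommModel K m →ₗ[K] ClassTwoModel K m ⊗[K] ClassTwoModel K m :=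
  LinearMap.snd K _ _ ∘ₗ LinearMap.snd K _ _

/-- The element with given components. -/
def of (s l : ClassTwoModel K m) (a : ClassTwoModel K m ⊗[K] ClassTwoModel K m) :
    WeakCommModel K m := (s, l, a)

section Components

variable (s l : ClassTwoModel K m) (a : ClassTwoModel K m ⊗[K] ClassTwoModel K m)

@[simp] theorem even_of : even (of s l a) = s := rfl

@[simp] theorem odd_of : odd (of s l a) = l := rfl

@[simp] theorem tensor_of : tensor (of s l a) = a := rfl

end Components

theorem ext_coord {x y : WeakCommModel K m} (h1 : even x = even y) (h2 : odd x = odd y)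
    (h3 : tensor x = tensor y) : x = y :=
  Prod.ext h1 (Prod.ext h2 h3)

/-- The third component encodes both [odd, odd] = wedge and [even, even] = 2 even - wedge; hence the
doubled bracket in the first component and the opposite signs of the two tensor terms. -/
instance : Bracket (WeakCommModel K m) (WeakCommModel K m) where
  bracket x y := (⁅even x, even y⁆ + ⁅even x, even y⁆, ⁅even x, odd y⁆ - ⁅even y, odd x⁆,
    ⁅even x, tensor y⁆ - ⁅even y, tensor x⁆
      + (odd x ⊗ₜ odd y - odd y ⊗ₜ odd x) - (even x ⊗ₜ even y - even y ⊗ₜ even x))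

theorem even_lie (x y : WeakCommModel K m) :
    even ⁅x, y⁆ = ⁅even x, even y⁆ + ⁅even x, even y⁆ := rfl

theorem odd_lie (x y : WeakCommModel K m) : odd ⁅x, y⁆ = ⁅even x, odd y⁆ - ⁅even y, odd x⁆ := rfl

theorem tensor_lie (x y : WeakCommModel K m) :
    tensor ⁅x, y⁆ = ⁅even x, tensor y⁆ - ⁅even y, tensor x⁆
      + (odd x ⊗ₜ odd y - odd y ⊗ₜ odd x) - (even x ⊗ₜ even y - even y ⊗ₜ even x) := rfl

/-- Brackets of H act as zero on H ⊗ H, so the actions commute. The remaining terms in s, s', s''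
cancel because the even bracket is doubled. -/
theorem tensor_leibniz (x y z : WeakCommModel K m) :
    tensor ⁅x, ⁅y, z⁆⁆ = tensor (⁅⁅x, y⁆, z⁆ + ⁅y, ⁅x, z⁆⁆) := by
  rw [map_add]
  simp only [tensor_lie, even_lie, odd_lie]
  generalize even x = s, even y = s', even z = s'', odd x = l, odd y = l', odd z = l'',
    tensor x = a, tensor y = a', tensor z = a''
  simp only [lie_add, lie_sub, add_lie, TensorProduct.LieModule.lie_tmul_right,
    TensorProduct.add_tmul, TensorProduct.tmul_add, TensorProduct.sub_tmul,
    TensorProduct.tmul_sub, ClassTwoModel.lie_lie_tensor_eq_zero]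
  rw [ClassTwoModel.lie_lie_tensor_comm s s', ClassTwoModel.lie_lie_tensor_comm s s'',
    ClassTwoModel.lie_lie_tensor_comm s' s'', ← lie_skew s' s, ← lie_skew s'' s, ← lie_skew s'' s']
  simp only [TensorProduct.neg_tmul, TensorProduct.tmul_neg]
  abel

instance : LieRing (WeakCommModel K m) where
  add_lie x y z := by
    refine ext_coord ?_ ?_ ?_
    · simp only [map_add, even_lie, add_lie]; abel
    · simp only [map_add, odd_lie, add_lie, lie_add]; abel
    · simp only [map_add, tensor_lie, add_lie, lie_add, TensorProduct.add_tmul,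
        TensorProduct.tmul_add]
      abel
  lie_add x y z := by
    refine ext_coord ?_ ?_ ?_
    · simp only [map_add, even_lie, lie_add]; abel
    · simp only [map_add, odd_lie, add_lie, lie_add]; abel
    · simp only [map_add, tensor_lie, add_lie, lie_add, TensorProduct.add_tmul,
        TensorProduct.tmul_add]
      abel
  lie_self x := by
    refine ext_coord ?_ ?_ ?_
    · simp [even_lie]
    · simp [odd_lie]
    · simp [tensor_lie]
  leibniz_lie x y z := by
    refine ext_coord ?_ ?_ (tensor_leibniz x y z)
    · simp [even_lie, ClassTwoModel.lie_lie_eq_zero]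
    · simp [even_lie, odd_lie, ClassTwoModel.lie_lie_eq_zero]

instance : LieAlgebra K (WeakCommModel K m) where
  lie_smul t x y := by
    refine ext_coord ?_ ?_ ?_
    · simp [even_lie]
    · simp [odd_lie, smul_sub]
    · simp [tensor_lie, smul_sub, smul_add, TensorProduct.smul_tmul']

end WeakCommModel

end Model

theorem linearIndependent_of_dual_eq_ite {K ι M : Type*} [Field K] [AddCommGroup M] [Module K M]
    [DecidableEq ι] (x : ι → M) (φ : ι → M →ₗ[K] K) (c : ι → K) (hc : ∀ i, c i ≠ 0)
    (h : ∀ i j, φ i (x j) = if i = j then c i else 0) : LinearIndependent K x := by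
  rw [linearIndependent_iff']
  intro s g hg i hi
  have := congrArg (φ i) hg
  rw [map_sum, map_zero] at this
  simpa [h, hi, hc i] using this

/-! ### Linear independence of the Jacobi family -/

section ModelHom

variable {K : Type u} [Field K] {m : ℕ} {𝔤 : Type v} [LieRing 𝔤] [LieAlgebra K 𝔤]

namespace WeakCommModel

/-- The homomorphism `x ↦ (p x / 2, t p x / 2, 0)`, for `t = 1` or `t = -1`. -/
def ofHom (h2 : (2 : K) ≠ 0) (p : 𝔤 →ₗ⁅K⁆ ClassTwoModel K m) (t : K) (ht : t * t = 1) :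
    𝔤 →ₗ⁅K⁆ WeakCommModel K m where
  toFun x := of ((2⁻¹ : K) • p x) ((t * 2⁻¹ : K) • p x) 0
  map_add' x y := by
    refine ext_coord ?_ ?_ ?_ <;> simp
  map_smul' r x := by
    refine ext_coord ?_ ?_ ?_ <;> simp [smul_comm r]
  map_lie' {x y} := by
    have h4 : (2⁻¹ : K) = 2⁻¹ * 2⁻¹ + 2⁻¹ * 2⁻¹ := by field_simp; norm_num
    refine ext_coord ?_ ?_ ?_
    · rw [even_lie, even_of, even_of, even_of, LieHom.map_lie, smul_lie, lie_smul, smul_smul,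
        ← add_smul, ← h4]
    · rw [odd_lie, even_of, even_of, odd_of, odd_of, odd_of, LieHom.map_lie, smul_lie, lie_smul,
        smul_lie, lie_smul, ← lie_skew (p y), smul_neg, smul_neg, sub_neg_eq_add, smul_smul,
        ← add_smul]
      congr 1
      linear_combination t * h4
    -- As t² = 1, the odd and even tensor terms are equal and cancel.
    · have ht' : t * 2⁻¹ * (t * 2⁻¹) = 2⁻¹ * 2⁻¹ := by linear_combination 2⁻¹ * 2⁻¹ * ht
      rw [tensor_lie]
      simp only [even_of, odd_of, tensor_of, lie_zero, TensorProduct.smul_tmul_smul, ht']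
      abel

theorem ofHom_apply (h2 : (2 : K) ≠ 0) (p : 𝔤 →ₗ⁅K⁆ ClassTwoModel K m) (t : K) (ht : t * t = 1)
    (x : 𝔤) : ofHom h2 p t ht x = of ((2⁻¹ : K) • p x) ((t * 2⁻¹ : K) • p x) 0 := rfl

/-- The representation of `χ(𝔤)` in the model that is induced by a homomorphism
`𝔤 → ClassTwoModel K m`. -/
def repr (h2 : (2 : K) ≠ 0) (p : 𝔤 →ₗ⁅K⁆ ClassTwoModel K m) :
    WeakComm K 𝔤 →ₗ⁅K⁆ WeakCommModel K m :=
  WeakComm.lift K (ofHom h2 p 1 (by norm_num)) (ofHom h2 p (-1) (by norm_num)) (fun x => by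
    rw [ofHom_apply, ofHom_apply]
    refine ext_coord ?_ ?_ ?_
    · simp [even_lie]
    · simp [odd_lie]
    · simp [tensor_lie, TensorProduct.tmul_neg, TensorProduct.neg_tmul])

theorem repr_odd (h2 : (2 : K) ≠ 0) (p : 𝔤 →ₗ⁅K⁆ ClassTwoModel K m) (x : 𝔤) :
    repr h2 p (WeakComm.odd K x) = of 0 (p x) 0 := by
  rw [WeakComm.odd_apply, map_sub, repr, WeakComm.lift_inl, WeakComm.lift_inr, ofHom_apply,
    ofHom_apply]
  refine ext_coord ?_ ?_ ?_
  · simp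
  · have h : (2⁻¹ : K) + 2⁻¹ = 1 := by field_simp; norm_num
    simp [← add_smul, h]
  · simp

theorem tensor_repr_wedge (h2 : (2 : K) ≠ 0) (p : 𝔤 →ₗ⁅K⁆ ClassTwoModel K m) (x y : 𝔤) :
    tensor (repr h2 p (WeakComm.wedge K x y)) = p x ⊗ₜ p y - p y ⊗ₜ p x := by
  rw [WeakComm.wedge_apply, LieHom.map_lie, repr_odd, repr_odd, tensor_lie]
  simp

/-- The functional on the third summand that is the product of two functionals. -/
def dual (α β : ClassTwoModel K m →ₗ[K] K) : WeakCommModel K m →ₗ[K] K :=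
  LinearMap.mul' K K ∘ₗ TensorProduct.map α β ∘ₗ tensor

theorem dual_repr_jac (h2 : (2 : K) ≠ 0) (p : 𝔤 →ₗ⁅K⁆ ClassTwoModel K m)
    (α β : ClassTwoModel K m →ₗ[K] K) (x y z : 𝔤) :
    dual α β (repr h2 p (WeakComm.jac K x y z)) =
      (α (p x) * β ⁅p y, p z⁆ - α ⁅p y, p z⁆ * β (p x))
        - (α (p y) * β ⁅p x, p z⁆ - α ⁅p x, p z⁆ * β (p y))
        + (α (p z) * β ⁅p x, p y⁆ - α ⁅p x, p y⁆ * β (p z)) := by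
  simp only [dual, LinearMap.comp_apply, WeakComm.jac_apply, map_add, map_sub, tensor_repr_wedge,
    LieHom.map_lie, TensorProduct.map_tmul, LinearMap.mul'_apply]

open ClassTwoModel

/-- The functionals dual to the images of the family `WeakComm.jacFamily`. -/
def dualFamily (K : Type u) [Field K] (m : ℕ) :
    (Fin 3 ↪o Fin m) ⊕ (Fin 2 ↪o Fin (m.choose 2)) → WeakCommModel K m →ₗ[K] K
  | Sum.inl f => dual (coordFst (f 0)) (coordSnd (f 1) (f 2))
  | Sum.inr f => dual (coordSnd (pairEnum m (f 0) 0) (pairEnum m (f 0) 1))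
      (coordSnd (pairEnum m (f 1) 0) (pairEnum m (f 1) 1))

theorem coordSnd_lie_gen {i j a b : Fin m} (hij : i < j) (hab : a < b) :
    coordSnd i j ⁅gen (K := K) a, gen (K := K) b⁆ = if i = a ∧ j = b then 1 else 0 := by
  rw [coordSnd_lie, coordFst_gen, coordFst_gen, coordFst_gen, coordFst_gen]
  split_ifs <;> first | omega | simp

/-- With both triples increasing, i is the least index on one side and a on the other, so only the
first summand can be nonzero. -/
theorem coordFst_mul_coordSnd_lie_gen {i j k a b c : Fin m} (hij : i < j) (hjk : j < k)
    (hab : a < b) (hbc : b < c) :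
    coordFst i (gen (K := K) a) * coordSnd j k ⁅gen (K := K) b, gen (K := K) c⁆
        - coordFst i (gen (K := K) b) * coordSnd j k ⁅gen (K := K) a, gen (K := K) c⁆
        + coordFst i (gen (K := K) c) * coordSnd j k ⁅gen (K := K) a, gen (K := K) b⁆
      = if i = a ∧ j = b ∧ k = c then 1 else 0 := by
  rw [coordSnd_lie_gen hjk hbc, coordSnd_lie_gen hjk (hab.trans hbc), coordSnd_lie_gen hjk hab,
    coordFst_gen, coordFst_gen, coordFst_gen]
  split_ifs <;> first | omega | simp

theorem orderEmbedding_two_eq_iff {ι : Type*} [LinearOrder ι] (f f' : Fin 2 ↪o ι) :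
    f = f' ↔ f 0 = f' 0 ∧ f 1 = f' 1 := by
  rw [← DFunLike.coe_fn_eq, funext_iff, Fin.forall_fin_two]

theorem orderEmbedding_three_eq_iff {ι : Type*} [LinearOrder ι] (f f' : Fin 3 ↪o ι) :
    f = f' ↔ f 0 = f' 0 ∧ f 1 = f' 1 ∧ f 2 = f' 2 := by
  rw [← DFunLike.coe_fn_eq, funext_iff, Fin.forall_fin_succ, Fin.forall_fin_two]
  rfl

theorem coordSnd_lie_gen_pair (f f' : Fin 2 ↪o Fin m) :
    coordSnd (f 0) (f 1) ⁅gen (K := K) (f' 0), gen (K := K) (f' 1)⁆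
      = if f = f' then 1 else 0 := by
  rw [coordSnd_lie_gen (f.strictMono (by decide)) (f'.strictMono (by decide)),
    if_congr (orderEmbedding_two_eq_iff f f') rfl rfl]

-- For pairs of pairs, the sign -1 comes from the term -α[x, y]β(z) of J(x, y, z). The term with the
-- two pairs interchanged vanishes, since both are listed increasingly.
open Classical in
theorem dualFamily_repr_jacFamily (h2 : (2 : K) ≠ 0) (p : 𝔤 →ₗ⁅K⁆ ClassTwoModel K m)
    (e : Fin m → 𝔤) (he : ∀ i, p (e i) = gen i)
    (i j : (Fin 3 ↪o Fin m) ⊕ (Fin 2 ↪o Fin (m.choose 2))) :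
    dualFamily K m i (repr h2 p (WeakComm.jacFamily K e j)) =
      if i = j then Sum.elim (fun _ => 1) (fun _ => -1) i else 0 := by
  rcases i with f | f <;> rcases j with f' | f'
  · simp only [dualFamily, WeakComm.jacFamily, dual_repr_jac, he, coordFst_lie, zero_mul, sub_zero,
      Sum.inl.injEq, Sum.elim_inl]
    rw [coordFst_mul_coordSnd_lie_gen (f.strictMono (by decide)) (f.strictMono (by decide))
      (f'.strictMono (by decide)) (f'.strictMono (by decide)),
      if_congr (orderEmbedding_three_eq_iff f f') rfl rfl]
  · simp only [dualFamily, WeakComm.jacFamily, dual_repr_jac, he, LieHom.map_lie, lie_lie_eq_zero,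
      coordFst_lie, map_zero, coordSnd_gen]
    simp
  · simp only [dualFamily, WeakComm.jacFamily, dual_repr_jac, he, coordSnd_gen]
    simp
  · have h : f 0 < f 1 := f.strictMono (by decide)
    have h' : f' 0 < f' 1 := f'.strictMono (by decide)
    simp only [dualFamily, WeakComm.jacFamily, dual_repr_jac, he, LieHom.map_lie, lie_lie_eq_zero,
      map_zero, coordSnd_lie_gen_pair, (pairEnum m).injective.eq_iff, Sum.inr.injEq, Sum.elim_inr,
      if_congr (orderEmbedding_two_eq_iff f f') rfl rfl]
    split_ifs <;> first | omega | simp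

theorem linearIndependent_jacFamily (h2 : (2 : K) ≠ 0) (p : 𝔤 →ₗ⁅K⁆ ClassTwoModel K m)
    (e : Fin m → 𝔤) (he : ∀ i, p (e i) = gen i) :
    LinearIndependent K (WeakComm.jacFamily K e) := by
  classical
  refine linearIndependent_of_dual_eq_ite _
    (fun i => dualFamily K m i ∘ₗ (repr h2 p : WeakComm K 𝔤 →ₗ[K] WeakCommModel K m))
    (Sum.elim (fun _ => 1) (fun _ => -1)) ?_ (fun i j => ?_)
  · rintro (i | i) <;> simp
  · exact dualFamily_repr_jacFamily h2 p e he i j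

end WeakCommModel

end ModelHom

/-! ### Application to free nilpotent Lie algebras -/

section FreeNilpotent

variable (K : Type u) [Field K] (m c : ℕ)

namespace FreeNilpotentLie

/-- The quotient map from the free Lie algebra. -/
def mk : FreeLieAlgebra K (Fin m) →ₗ⁅K⁆ FreeNilpotentLie K m c :=
  { (LieSubmodule.Quotient.mk' (LieModule.lowerCentralSeries K (FreeLieAlgebra K (Fin m))
      (FreeLieAlgebra K (Fin m)) c) : _ →ₗ[K] FreeNilpotentLie K m c) with
    map_lie' := fun {_ _} => rfl }

theorem mk_surjective : Function.Surjective (mk K m c) := by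
  rintro ⟨x⟩
  exact ⟨x, rfl⟩

variable {K m c} in
theorem mk_eq_zero {x : FreeLieAlgebra K (Fin m)} :
    mk K m c x = 0 ↔ x ∈ LieModule.lowerCentralSeries K (FreeLieAlgebra K (Fin m))
      (FreeLieAlgebra K (Fin m)) c :=
  LieSubmodule.Quotient.mk_eq_zero'

/-- The generators. -/
def gen (i : Fin m) : FreeNilpotentLie K m c := mk K m c (FreeLieAlgebra.of K i)

theorem lieSpan_range_gen :
    LieSubalgebra.lieSpan K (FreeNilpotentLie K m c) (Set.range (gen K m c)) = ⊤ := by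
  refine eq_top_iff.mpr fun x _ => ?_
  obtain ⟨y, rfl⟩ := mk_surjective K m c x
  exact FreeLieAlgebra.mem_of_forall_of_mem
    ((LieSubalgebra.lieSpan K (FreeNilpotentLie K m c) (Set.range (gen K m c))).comap (mk K m c))
    (fun i => LieSubalgebra.subset_lieSpan ⟨i, rfl⟩) y

theorem lie_lie_lie_eq_zero (hc : c ≤ 3) (x y z t : FreeNilpotentLie K m c) :
    ⁅x, ⁅y, ⁅z, t⁆⁆⁆ = 0 := by
  obtain ⟨x, rfl⟩ := mk_surjective K m c x
  obtain ⟨y, rfl⟩ := mk_surjective K m c y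
  obtain ⟨z, rfl⟩ := mk_surjective K m c z
  obtain ⟨t, rfl⟩ := mk_surjective K m c t
  rw [← LieHom.map_lie, ← LieHom.map_lie, ← LieHom.map_lie, mk_eq_zero]
  -- Index 3 is γ_4, which contains fourfold brackets and lies in γ_{c+1} as c ≤ 3.
  apply LieModule.antitone_lowerCentralSeries K _ _ hc
  rw [LieModule.lowerCentralSeries_succ, LieModule.lowerCentralSeries_succ,
    LieModule.lowerCentralSeries_succ]
  exact LieSubmodule.lie_mem_lie (LieSubmodule.mem_top x) (LieSubmodule.lie_mem_lie
    (LieSubmodule.mem_top y) (LieSubmodule.lie_mem_lie (LieSubmodule.mem_top z)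
    (LieSubmodule.mem_top t)))

theorem lowerCentralSeries_two_le_ker
    (p : FreeLieAlgebra K (Fin m) →ₗ⁅K⁆ ClassTwoModel K m) :
    LieModule.lowerCentralSeries K (FreeLieAlgebra K (Fin m)) (FreeLieAlgebra K (Fin m)) 2
      ≤ p.ker := by
  -- γ_2 maps into the centre of the model, so γ_3 (index 2) maps to zero.
  have h1 : LieModule.lowerCentralSeries K (FreeLieAlgebra K (Fin m)) (FreeLieAlgebra K (Fin m)) 1
      ≤ LieIdeal.comap p (LieAlgebra.center K (ClassTwoModel K m)) := by
    rw [LieModule.lowerCentralSeries_succ, LieSubmodule.lie_le_iff]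
    intro x _ y _
    rw [LieIdeal.mem_comap, LieModule.mem_maxTrivSubmodule]
    intro z
    rw [LieHom.map_lie, ClassTwoModel.lie_lie_eq_zero]
  rw [LieModule.lowerCentralSeries_succ, LieSubmodule.lie_le_iff]
  intro x _ y hy
  have := h1 hy
  rw [LieIdeal.mem_comap, LieModule.mem_maxTrivSubmodule] at this
  rw [LieHom.mem_ker, LieHom.map_lie, this]

/-- For `c ≥ 2`, the homomorphism onto the class two model that matches the generators. -/
def toClassTwoModel (hc : 2 ≤ c) : FreeNilpotentLie K m c →ₗ⁅K⁆ ClassTwoModel K m :=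
  { (LieModule.lowerCentralSeries K (FreeLieAlgebra K (Fin m))
        (FreeLieAlgebra K (Fin m)) c).toSubmodule.liftQ
      (FreeLieAlgebra.lift K (ClassTwoModel.gen : Fin m → ClassTwoModel K m) :
        FreeLieAlgebra K (Fin m) →ₗ[K] ClassTwoModel K m)
      (fun _ hz => lowerCentralSeries_two_le_ker K m _
        (LieModule.antitone_lowerCentralSeries K _ _ hc hz)) with
    map_lie' := by
      rintro ⟨x⟩ ⟨y⟩
      exact (FreeLieAlgebra.lift K (ClassTwoModel.gen : Fin m → ClassTwoModel K m)).map_lie x y }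

theorem toClassTwoModel_gen (hc : 2 ≤ c) (i : Fin m) :
    toClassTwoModel K m c hc (gen K m c i) = ClassTwoModel.gen i :=
  FreeLieAlgebra.lift_of_apply (R := K) ClassTwoModel.gen i

/-- In characteristic other than two, the family `WeakComm.jacFamily` is a basis of
`R(𝔫_{m,c})` for `c = 2, 3`. -/
theorem finrank_idealR (h2 : (2 : K) ≠ 0) (hc : 2 ≤ c) (hc' : c ≤ 3) :
    FiniteDimensional K (WeakComm.idealR K (FreeNilpotentLie K m c)) ∧
      Module.finrank K (WeakComm.idealR K (FreeNilpotentLie K m c)) =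
        m.choose 3 + (m.choose 2).choose 2 := by
  rw [WeakComm.idealR_eq_span_jacFamily h2 (lie_lie_lie_eq_zero K m c hc')
    (lieSpan_range_gen K m c)]
  refine ⟨FiniteDimensional.span_of_finite K (Set.finite_range _), ?_⟩
  rw [finrank_span_eq_card (WeakCommModel.linearIndependent_jacFamily h2
    (toClassTwoModel K m c hc) _ (toClassTwoModel_gen K m c hc)), Fintype.card_sum,
    card_orderEmbedding_fin, card_orderEmbedding_fin]

end FreeNilpotentLie

end FreeNilpotent

/-! ### The dimension as a polynomial in m, and the conclusion -/

theorem cast_choose_three_add_choose_choose_two (m : ℕ) :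
    ((m.choose 3 + (m.choose 2).choose 2 : ℕ) : ℚ) =
      (3 * (m : ℚ) ^ 4 - 2 * (m : ℚ) ^ 3 - 15 * (m : ℚ) ^ 2 + 14 * (m : ℚ)) / 24 := by
  have h3 : (m.choose 3 : ℚ) = m * (m - 1) * (m - 2) / 6 := by
    induction m with
    | zero => simp
    | succ n ih =>
      rw [Nat.choose_succ_succ, Nat.cast_add, ih, Nat.cast_choose_two]
      push_cast
      ring
  rw [Nat.cast_add, h3, Nat.cast_choose_two, Nat.cast_choose_two]
  ring

end

theorem mainTheorem9 {K : Type*} [Field K] (hK : ringChar K ≠ 2) (m : ℕ) :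
    FiniteDimensional K (WeakComm.idealR K (FreeNilpotentLie K m 2)) ∧
    FiniteDimensional K (WeakComm.idealR K (FreeNilpotentLie K m 3)) ∧
    Module.finrank K (WeakComm.idealR K (FreeNilpotentLie K m 2)) =
      Module.finrank K (WeakComm.idealR K (FreeNilpotentLie K m 3)) ∧
    (Module.finrank K (WeakComm.idealR K (FreeNilpotentLie K m 2)) : ℚ) =
      (3 * (m : ℚ) ^ 4 - 2 * (m : ℚ) ^ 3 - 15 * (m : ℚ) ^ 2 + 14 * (m : ℚ)) / 24 := by
  have h2 : (2 : K) ≠ 0 := Ring.two_ne_zero hK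
  obtain ⟨hf2, hr2⟩ := FreeNilpotentLie.finrank_idealR K m 2 h2 le_rfl (by norm_num)
  obtain ⟨hf3, hr3⟩ := FreeNilpotentLie.finrank_idealR K m 3 h2 (by norm_num) le_rfl
  refine ⟨hf2, hf3, hr2.trans hr3.symm, ?_⟩
  rw [hr2, cast_choose_three_add_choose_choose_two]
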